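/- Let $X$ be a reflexive real or complex Banach space and let $T$ be a bounded linear operator on $X$ that is power-bounded, i.e. $\sup_{n\ge 0}\|T^n\|<\infty$. Suppose that $T=\alpha I+S$ for some scalar $\alpha$ and some bounded linear operator $S$ on $X$ such that $S^k$ is compact for some $k$. Then both $T$ and its adjoint $T^*$ (acting on the dual space $X^*$ by $T^*f=f\circ T$) are almost periodic; that is, for every $x\in X$ the orbit $\{T^n x: n\ge 0\}$ is relatively compact in the norm topology of $X$, and for every $f\in X^*$ the orbit $\{(T^*)^n f: n\ge 0\}$ is relatively compact in the norm topology of $X^*$. -/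

import Mathlib

/-- A normed space is reflexive if the canonical embedding into its bidual is onto. -/
def IsReflexiveSpace (𝕜 : Type*) [RCLike 𝕜] (X : Type*) [NormedAddCommGroup X]
    [NormedSpace 𝕜 X] : Prop :=
  Function.Surjective (NormedSpace.inclusionInDoubleDual 𝕜 X)

/-- An operator is power-bounded if the norms of its powers are bounded. -/
def IsPowerBounded {𝕜 : Type*} [RCLike 𝕜] {X : Type*} [NormedAddCommGroup X]
    [NormedSpace 𝕜 X] (T : X →L[𝕜] X) : Prop :=
  ∃ M : ℝ, ∀ n : ℕ, ‖T ^ n‖ ≤ M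

/-- An operator is almost periodic if all its orbits `{T ^ n x : n ≥ 0}` are relatively compact
in the norm topology. -/
def IsAlmostPeriodicOperator {𝕜 : Type*} [RCLike 𝕜] {X : Type*} [NormedAddCommGroup X]
    [NormedSpace 𝕜 X] (T : X →L[𝕜] X) : Prop :=
  ∀ x : X, IsCompact (closure (Set.range fun n : ℕ => (T ^ n) x))

/-- The Banach-space adjoint `T* : X* → X*`, `T* f = f ∘ T`, on the normed dual. -/
noncomputable def banachAdjoint {𝕜 : Type*} [RCLike 𝕜] {X : Type*} [NormedAddCommGroup X]
    [NormedSpace 𝕜 X] (T : X →L[𝕜] X) : StrongDual 𝕜 X →L[𝕜] StrongDual 𝕜 X :=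
  ContinuousLinearMap.precomp 𝕜 T

open Filter Topology Metric Set

section TotallyBounded

variable {X : Type*} [PseudoMetricSpace X]

/-! The vectors with totally bounded orbit form a `T`-invariant subspace `M`, closed because `T` is
power-bounded. It contains the range of `S ^ k`, as `S ^ k` is compact and commutes with `T`. The
exponent is then lowered to `0`: if `M` contains the range of `S ^ (j + 1)`, then `T y - α • y ∈ M`
for `y = S ^ j x`, and `y ∈ M` follows by cases. For `‖α‖ ≠ 1` it comes from `T ^ N y - α ^ N • y ∈
M` and a geometric estimate; for `‖α‖ = 1`, from the mean ergodic decomposition of `α⁻¹ • T`, the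
only use of reflexivity. The adjoint satisfies the same hypotheses, by Schauder's theorem and
reflexivity of the dual. -/

theorem totallyBounded_range_of_approx {ι : Type*} {u : ι → X}
    (h : ∀ ε > 0, ∃ v : ι → X, TotallyBounded (range v) ∧ ∀ i, dist (u i) (v i) ≤ ε) :
    TotallyBounded (range u) := by
  refine Metric.totallyBounded_iff.2 fun ε hε => ?_
  obtain ⟨v, hv, huv⟩ := h (ε / 2) (half_pos hε)
  obtain ⟨t, ht, hvt⟩ := Metric.totallyBounded_iff.1 hv (ε / 2) (half_pos hε)
  refine ⟨t, ht, ?_⟩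
  rintro _ ⟨i, rfl⟩
  obtain ⟨y, hy, hiy⟩ := mem_iUnion₂.1 (hvt (mem_range_self i))
  refine mem_iUnion₂.2 ⟨y, hy, ?_⟩
  rw [mem_ball] at hiy ⊢
  linarith [dist_triangle (u i) (v i) y, huv i]

end TotallyBounded

/-! ### The closed invariant subspace of almost periodic vectors -/

section AlmostPeriodicVectors

variable {𝕜 : Type*} [RCLike 𝕜] {X : Type*} [NormedAddCommGroup X] [NormedSpace 𝕜 X]

theorem IsPowerBounded.exists_pos_bound {T : X →L[𝕜] X} (hT : IsPowerBounded T) :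
    ∃ M : ℝ, 0 < M ∧ ∀ (n : ℕ) (x : X), ‖(T ^ n) x‖ ≤ M * ‖x‖ := by
  obtain ⟨M, hM⟩ := hT
  refine ⟨max M 1, by positivity, fun n x => (T ^ n).le_of_opNorm_le ?_ x⟩
  exact (hM n).trans (le_max_left _ _)

variable [CompleteSpace X]

/-- The invariant subspace of vectors whose orbit is totally bounded. -/
def almostPeriodicVectors (T : X →L[𝕜] X) : Submodule 𝕜 X where
  carrier := {x | TotallyBounded (range fun n : ℕ => (T ^ n) x)}
  zero_mem' := by simp
  add_mem' {x y} hx hy := by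
    have hc := ((hx.closure.isCompact_of_isClosed isClosed_closure).add
      (hy.closure.isCompact_of_isClosed isClosed_closure)).totallyBounded
    refine hc.subset ?_
    rintro _ ⟨n, rfl⟩
    exact ⟨_, subset_closure ⟨n, rfl⟩, _, subset_closure ⟨n, rfl⟩, by simp⟩
  smul_mem' c x hx := by
    refine (TotallyBounded.image hx (uniformContinuous_const_smul c)).subset ?_
    rintro _ ⟨n, rfl⟩
    exact ⟨_, ⟨n, rfl⟩, by simp⟩

variable {T : X →L[𝕜] X}

theorem mem_almostPeriodicVectors {x : X} :
    x ∈ almostPeriodicVectors T ↔ TotallyBounded (range fun n : ℕ => (T ^ n) x) := Iff.rfl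

theorem isAlmostPeriodicOperator_of_forall_mem (h : ∀ x, x ∈ almostPeriodicVectors T) :
    IsAlmostPeriodicOperator T := fun x =>
  (TotallyBounded.closure (h x)).isCompact_of_isClosed isClosed_closure

theorem apply_mem_almostPeriodicVectors {x : X} (hx : x ∈ almostPeriodicVectors T) :
    T x ∈ almostPeriodicVectors T := by
  refine TotallyBounded.subset ?_ (mem_almostPeriodicVectors.1 hx)
  rintro _ ⟨n, rfl⟩
  exact ⟨n + 1, by simp [pow_succ]⟩

theorem IsPowerBounded.isClosed_almostPeriodicVectors (hT : IsPowerBounded T) :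
    IsClosed (almostPeriodicVectors T : Set X) := by
  obtain ⟨M, hM0, hM⟩ := hT.exists_pos_bound
  refine isClosed_of_closure_subset fun x hx => totallyBounded_range_of_approx fun ε hε => ?_
  obtain ⟨y, hy, hxy⟩ := Metric.mem_closure_iff.1 hx (ε / M) (by positivity)
  refine ⟨fun n => (T ^ n) y, hy, fun n => ?_⟩
  rw [dist_eq_norm, ← map_sub]
  refine (hM n _).trans ?_
  rw [dist_eq_norm, lt_div_iff₀' hM0] at hxy
  exact hxy.le

theorem mem_almostPeriodicVectors_of_apply_eq_smul {x : X} {α : 𝕜} (hα : ‖α‖ ≤ 1)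
    (hx : T x = α • x) : x ∈ almostPeriodicVectors T := by
  have hn : ∀ n : ℕ, (T ^ n) x = α ^ n • x := fun n => by
    induction n with
    | zero => simp
    | succ n ih => simp [pow_succ, hx, ih, smul_smul, mul_comm]
  have hc : IsCompact ((fun c : 𝕜 => c • x) '' closedBall 0 1) :=
    (isCompact_closedBall 0 1).image (by fun_prop)
  refine hc.totallyBounded.subset ?_
  rintro _ ⟨n, rfl⟩
  exact ⟨α ^ n, by simpa using pow_le_one₀ (norm_nonneg α) hα, (hn n).symm⟩

/-- Vectors in the range of a compact operator commuting with `T` are almost periodic. -/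
theorem IsPowerBounded.apply_mem_almostPeriodicVectors_of_commute (hT : IsPowerBounded T)
    {K : X →L[𝕜] X} (hK : IsCompactOperator K) (hTK : Commute T K) (x : X) :
    K x ∈ almostPeriodicVectors T := by
  obtain ⟨M, -, hM⟩ := hT.exists_pos_bound
  obtain ⟨C, hC, hKC⟩ := hK.image_closedBall_subset_compact (f := K.toLinearMap) (M * ‖x‖)
  refine hC.totallyBounded.subset ?_
  rintro _ ⟨n, rfl⟩
  refine hKC ⟨(T ^ n) x, by simpa using hM n x, ?_⟩
  exact congr($((hTK.pow_left n).eq.symm) x)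

variable {α : 𝕜}

theorem pow_apply_sub_pow_smul_mem_almostPeriodicVectors {x : X}
    (hx : T x - α • x ∈ almostPeriodicVectors T) (n : ℕ) :
    (T ^ n) x - α ^ n • x ∈ almostPeriodicVectors T := by
  induction n with
  | zero => simp
  | succ n ih =>
    have h : (T ^ (n + 1)) x - α ^ (n + 1) • x
        = T ((T ^ n) x - α ^ n • x) + α ^ n • (T x - α • x) := by
      simp [pow_succ' T, pow_succ α, smul_sub, smul_smul]
    rw [h]
    exact add_mem (apply_mem_almostPeriodicVectors ih) (Submodule.smul_mem _ _ hx)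

/-- For `n ≥ N`, replacing `T ^ N x` by `T ^ N x - α ^ N • x ∈ M` moves `T ^ n x` by at most `‖α‖ ^
N * (M * ‖x‖)`, with `M` here the power bound; the terms `n < N` are finitely many. -/
theorem IsPowerBounded.mem_almostPeriodicVectors_of_norm_lt_one (hT : IsPowerBounded T)
    (hα : ‖α‖ < 1) {x : X} (hx : T x - α • x ∈ almostPeriodicVectors T) :
    x ∈ almostPeriodicVectors T := by
  obtain ⟨M, -, hM⟩ := hT.exists_pos_bound
  refine totallyBounded_range_of_approx fun ε hε => ?_
  have hlim : Tendsto (fun N : ℕ => ‖α‖ ^ N * (M * ‖x‖)) atTop (𝓝 0) := by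
    simpa using (tendsto_pow_atTop_nhds_zero_of_lt_one (norm_nonneg α) hα).mul_const (M * ‖x‖)
  obtain ⟨N, hN⟩ := (hlim.eventually (gt_mem_nhds hε)).exists
  refine ⟨fun n => if n < N then (T ^ n) x else (T ^ (n - N)) ((T ^ N) x - α ^ N • x), ?_, ?_⟩
  · refine (((finite_lt_nat N).image fun n => (T ^ n) x).totallyBounded.union
      (mem_almostPeriodicVectors.1
        (pow_apply_sub_pow_smul_mem_almostPeriodicVectors hx N))).subset ?_
    rintro _ ⟨n, rfl⟩
    by_cases hn : n < N
    · exact Or.inl ⟨n, hn, by simp [hn]⟩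
    · exact Or.inr ⟨n - N, by simp [hn]⟩
  · intro n
    by_cases hn : n < N
    · simp [hn, hε.le]
    · have h : (T ^ n) x = (T ^ (n - N)) ((T ^ N) x) := by
        rw [← mul_apply_eq_comp, ← pow_add, Nat.sub_add_cancel (not_lt.1 hn)]
      simp only [hn, if_false, map_sub, map_smul, dist_eq_norm, h, sub_sub_cancel, norm_smul,
        norm_pow]
      exact (mul_le_mul_of_nonneg_left (hM _ _) (by positivity)).trans hN.le

/-- Dividing `T ^ N x - α ^ N • x` by `-α ^ N` gives almost periodic vectors converging to `x`. -/
theorem IsPowerBounded.mem_almostPeriodicVectors_of_one_lt_norm (hT : IsPowerBounded T)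
    (hα : 1 < ‖α‖) {x : X} (hx : T x - α • x ∈ almostPeriodicVectors T) :
    x ∈ almostPeriodicVectors T := by
  obtain ⟨M, -, hM⟩ := hT.exists_pos_bound
  have hα0 : α ≠ 0 := norm_pos_iff.1 (one_pos.trans hα)
  have hlim : Tendsto (fun N : ℕ => (α⁻¹) ^ N • (T ^ N) x) atTop (𝓝 0) := by
    have h0 : Tendsto (fun N : ℕ => ‖α⁻¹‖ ^ N * (M * ‖x‖)) atTop (𝓝 0) := by
      simpa using (tendsto_pow_atTop_nhds_zero_of_lt_one (norm_nonneg α⁻¹)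
        (by rw [norm_inv]; exact inv_lt_one_of_one_lt₀ hα)).mul_const (M * ‖x‖)
    refine squeeze_zero_norm (fun N => ?_) h0
    rw [norm_smul, norm_pow]
    exact mul_le_mul_of_nonneg_left (hM _ _) (by positivity)
  have hlim' : Tendsto (fun N : ℕ => x - (α⁻¹) ^ N • (T ^ N) x) atTop (𝓝 x) := by
    simpa using tendsto_const_nhds.sub hlim
  refine hT.isClosed_almostPeriodicVectors.mem_of_tendsto hlim' (Eventually.of_forall fun N => ?_)
  have h := Submodule.smul_mem _ (-(α⁻¹) ^ N)
    (pow_apply_sub_pow_smul_mem_almostPeriodicVectors hx N)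
  have e : x - (α⁻¹) ^ N • (T ^ N) x = (-(α⁻¹) ^ N) • ((T ^ N) x - α ^ N • x) := by
    rw [smul_sub, smul_smul, neg_mul, ← mul_pow, inv_mul_cancel₀ hα0]
    simp
    abel
  rw [e]
  exact h

end AlmostPeriodicVectors

/-! ### Reflexivity and the mean ergodic theorem -/

section Reflexive

variable {𝕜 : Type*} [RCLike 𝕜] {X : Type*} [NormedAddCommGroup X] [NormedSpace 𝕜 X]

theorem IsReflexiveSpace.dual (hX : IsReflexiveSpace 𝕜 X) :
    IsReflexiveSpace 𝕜 (StrongDual 𝕜 X) := by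
  intro Ψ
  refine ⟨Ψ.comp (NormedSpace.inclusionInDoubleDual 𝕜 X), ?_⟩
  ext φ
  obtain ⟨x, rfl⟩ := hX φ
  simp

/-- Bounded sequences in a reflexive space have weak cluster points. -/
theorem IsReflexiveSpace.exists_weak_limit (hX : IsReflexiveSpace 𝕜 X) {ι : Type*}
    (F : Ultrafilter ι) {u : ι → X} {C : ℝ} (hu : ∀ i, ‖u i‖ ≤ C) :
    ∃ z : X, ∀ f : StrongDual 𝕜 X, Tendsto (fun i => f (u i)) F (𝓝 (f z)) := by
  let J : X → WeakDual 𝕜 (StrongDual 𝕜 X) := fun x =>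
    StrongDual.toWeakDual (NormedSpace.inclusionInDoubleDual 𝕜 X x)
  have hJ : ∀ᶠ φ in (F.map (fun i => J (u i)) : Filter (WeakDual 𝕜 (StrongDual 𝕜 X))),
      φ ∈ WeakDual.toStrongDual ⁻¹' closedBall (0 : StrongDual 𝕜 (StrongDual 𝕜 X)) C := by
    refine Filter.mem_map.2 (Eventually.of_forall fun i => ?_)
    change dist (NormedSpace.inclusionInDoubleDual 𝕜 X (u i)) 0 ≤ C
    rw [dist_zero_right (NormedSpace.inclusionInDoubleDual 𝕜 X (u i))]
    exact (NormedSpace.double_dual_bound 𝕜 X (u i)).trans (hu i)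
  obtain ⟨φ, -, hφ⟩ := (WeakDual.isCompact_closedBall
    (0 : StrongDual 𝕜 (StrongDual 𝕜 X)) C).ultrafilter_le_nhds _ (le_principal_iff.2 hJ)
  obtain ⟨z, hz⟩ := hX (WeakDual.toStrongDual φ)
  refine ⟨z, fun f => ?_⟩
  have h1 : Tendsto (fun i => J (u i) f) F (𝓝 (φ f)) :=
    ((WeakDual.eval_continuous f).tendsto φ).comp hφ
  have h2 : φ f = f z := by
    rw [← NormedSpace.dual_def 𝕜 X z f, hz]; rfl
  rw [← h2]
  exact h1

/-- Hahn–Banach in the quotient by the closure of `p`. -/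
theorem Submodule.mem_topologicalClosure_of_dual (p : Submodule 𝕜 X) {x : X}
    (h : ∀ f : StrongDual 𝕜 X, (∀ y ∈ p, f y = 0) → f x = 0) : x ∈ p.topologicalClosure := by
  by_contra hx
  set q := p.topologicalClosure
  have hq : IsClosed (q : Set X) := p.isClosed_topologicalClosure
  have hx0 : q.mkQL x ≠ 0 := by simpa [Submodule.Quotient.mk_eq_zero] using hx
  obtain ⟨g, -, hg⟩ := exists_dual_vector 𝕜 (q.mkQL x) (norm_ne_zero_iff.2 hx0)
  have h0 : (g.comp q.mkQL) x = 0 := h _ fun y hy => by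
    have : q.mkQL y = 0 := by
      simpa [Submodule.Quotient.mk_eq_zero] using p.le_topologicalClosure hy
    simp [this]
  simp only [ContinuousLinearMap.comp_apply] at h0
  rw [h0] at hg
  exact hx0 (norm_eq_zero.1 (by exact_mod_cast hg.symm))

/-- The mean ergodic decomposition of a power-bounded operator on a reflexive space. -/
theorem IsReflexiveSpace.exists_fixed_sub_mem_closure_range (hX : IsReflexiveSpace 𝕜 X)
    {U : X →L[𝕜] X} (hU : IsPowerBounded U) (x : X) :
    ∃ z : X, U z = z ∧ x - z ∈ (LinearMap.range ((U - 1 : X →L[𝕜] X) : X →ₗ[𝕜] X)).topologicalClosure := by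
  obtain ⟨M, hM⟩ := hU
  have hiter : ∀ n : ℕ, U^[n] x = (U ^ n) x := fun n => by
    simp
  have hM' : ∀ n : ℕ, ‖U^[n] x‖ ≤ M * ‖x‖ := fun n => by
    rw [hiter]; exact (U ^ n).le_of_opNorm_le (hM n) x
  have hC0 : 0 ≤ M * ‖x‖ := (norm_nonneg _).trans (hM' 0)
  let A : ℕ → X := fun n => birkhoffAverage 𝕜 U id n x
  have hA : ∀ n, ‖A n‖ ≤ M * ‖x‖ := fun n => by
    simp only [A, birkhoffAverage, birkhoffSum, id, norm_smul, norm_inv, RCLike.norm_natCast]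
    rcases n.eq_zero_or_pos with rfl | hn
    · simpa using hC0
    · rw [inv_mul_le_iff₀ (by positivity)]
      refine (norm_sum_le_of_le _ fun i _ => hM' i).trans ?_
      simp
  -- A free ultrafilter replaces the extraction of a weakly convergent subsequence of the averages.
  obtain ⟨z, hz⟩ := hX.exists_weak_limit (Filter.hyperfilter ℕ) hA
  have hle : (Filter.hyperfilter ℕ : Filter ℕ) ≤ atTop := by
    rw [← Nat.cofinite_eq_atTop]; exact Filter.hyperfilter_le_cofinite
  refine ⟨z, ?_, ?_⟩
  · have hdiff : Tendsto (fun n => U (A n) - A n) atTop (𝓝 0) := by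
      have := tendsto_birkhoffAverage_apply_sub_birkhoffAverage (f := U) (g := (id : X → X)) 𝕜
        (x := x) (by
          refine (Metric.isBounded_closedBall (x := (0 : X)) (r := M * ‖x‖)).subset ?_
          rintro _ ⟨n, rfl⟩
          simpa using hM' n)
      refine this.congr fun n => ?_
      simp only [A, birkhoffAverage, birkhoffSum, map_smul, map_sum, id,
        ← Function.iterate_succ_apply' (⇑U), Function.iterate_succ_apply]
    refine (SeparatingDual.eq_iff_forall_dual_eq (R := 𝕜)).2 fun f => ?_
    have h1 : Tendsto (fun n => f (U (A n) - A n)) (Filter.hyperfilter ℕ) (𝓝 0) := by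
      simpa [Function.comp_def] using ((f.continuous.tendsto 0).comp hdiff).mono_left hle
    have h2 : Tendsto (fun n => f (U (A n) - A n)) (Filter.hyperfilter ℕ)
        (𝓝 (f (U z) - f z)) := by
      simpa using (hz (f.comp U)).sub (hz f)
    exact sub_eq_zero.1 (tendsto_nhds_unique h2 h1)
  -- A functional killing the range of `U - 1` is constant along the orbit, hence equal to `f x` on
  -- every nonempty average and at `z`.
  · refine Submodule.mem_topologicalClosure_of_dual _ fun f hf => ?_
    have hfU : ∀ y, f (U y) = f y := fun y => by
      have := hf _ ⟨y, rfl⟩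
      exact sub_eq_zero.1 (by simpa using this)
    have hfn : ∀ n : ℕ, f (U^[n] x) = f x := fun n => by
      induction n with
      | zero => rfl
      | succ n ih => rw [Function.iterate_succ_apply', hfU, ih]
    have hfA : ∀ n ≥ 1, f (A n) = f x := fun n hn => by
      have hn0 : (n : 𝕜) ≠ 0 := by exact_mod_cast (Nat.pos_iff_ne_zero.1 hn)
      simp [A, birkhoffAverage, birkhoffSum, hfn, hn0]
    have h1 : Tendsto (fun n => f (A n)) (Filter.hyperfilter ℕ) (𝓝 (f x)) := by
      refine (tendsto_const_nhds.congr' ?_ : Tendsto _ atTop _).mono_left hle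
      exact (eventually_ge_atTop 1).mono fun n hn => (hfA n hn).symm
    rw [map_sub, tendsto_nhds_unique h1 (hz f), sub_self]

end Reflexive

/-! ### Adjoints and Schauder's theorem -/

section Adjoint

variable {𝕜 : Type*} [RCLike 𝕜] {X : Type*} [NormedAddCommGroup X] [NormedSpace 𝕜 X]

theorem banachAdjoint_apply_apply (T : X →L[𝕜] X) (f : StrongDual 𝕜 X) (x : X) :
    banachAdjoint T f x = f (T x) := rfl

theorem banachAdjoint_pow (T : X →L[𝕜] X) (n : ℕ) :
    banachAdjoint T ^ n = banachAdjoint (T ^ n) := by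
  induction n with
  | zero => ext f x; simp [banachAdjoint_apply_apply]
  | succ n ih =>
    ext f x
    rw [pow_succ, ih, pow_succ']
    simp [banachAdjoint_apply_apply]

theorem norm_banachAdjoint_le (T : X →L[𝕜] X) : ‖banachAdjoint T‖ ≤ ‖T‖ := by
  refine ContinuousLinearMap.opNorm_le_bound _ (norm_nonneg _) fun f => ?_
  rw [mul_comm]
  exact f.opNorm_comp_le T

theorem IsPowerBounded.banachAdjoint {T : X →L[𝕜] X} (hT : IsPowerBounded T) :
    IsPowerBounded (banachAdjoint T) := by
  obtain ⟨M, hM⟩ := hT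
  refine ⟨M, fun n => ?_⟩
  rw [banachAdjoint_pow]
  exact (norm_banachAdjoint_le _).trans (hM n)

/-- **Schauder's theorem**: the adjoint of a compact operator is compact. -/
theorem IsCompactOperator.banachAdjoint {K : X →L[𝕜] X} (hK : IsCompactOperator K) :
    IsCompactOperator (banachAdjoint K) := by
  obtain ⟨C, hC, hKC⟩ := hK.image_closedBall_subset_compact (f := K.toLinearMap) 1
  let B : Set (WeakDual 𝕜 X) := WeakDual.toStrongDual ⁻¹' closedBall (0 : StrongDual 𝕜 X) 1
  have hB : IsCompact B := WeakDual.isCompact_closedBall 0 1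
  -- On the unit ball, weak-* convergence is uniform on the compact set `C`, so `g ↦ g ∘ K` is
  -- weak-* to norm continuous there; Alaoglu then gives a compact image.
  have hcont : ContinuousOn
      (fun g : WeakDual 𝕜 X => _root_.banachAdjoint K (WeakDual.toStrongDual g)) B := by
    intro g hg
    refine Metric.tendsto_nhds.2 fun ε hε => ?_
    obtain ⟨t, ht, hCt⟩ := Metric.totallyBounded_iff.1 hC.totallyBounded (ε / 4) (by positivity)
    have hev : ∀ᶠ g' in 𝓝[B] g, ∀ y ∈ t, dist (g' y) (g y) < ε / 4 :=
      (ht.eventually_all).2 fun y _ => nhdsWithin_le_nhds <|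
        Metric.tendsto_nhds.1 ((WeakDual.eval_continuous y).tendsto g) _ (by positivity)
    filter_upwards [hev, self_mem_nhdsWithin] with g' hg' hB'
    have hnorm : ∀ h ∈ B, ∀ v, ‖h v‖ ≤ ‖v‖ := fun h hh v => by
      have h1 : ‖WeakDual.toStrongDual h‖ ≤ 1 := by simpa [B] using hh
      simpa using (WeakDual.toStrongDual h).le_of_opNorm_le h1 v
    refine lt_of_le_of_lt ?_ (show 3 * (ε / 4) < ε by linarith)
    rw [dist_eq_norm]
    refine ContinuousLinearMap.opNorm_le_of_unit_norm (by positivity) fun x hx => ?_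
    obtain ⟨y, hy, hxy⟩ := mem_iUnion₂.1 (hCt (hKC ⟨x, by simp [hx], rfl⟩))
    replace hxy : ‖K x - y‖ < ε / 4 := by simpa [dist_eq_norm] using hxy
    have hgy : ‖g' y - g y‖ < ε / 4 := by simpa [dist_eq_norm] using hg' y hy
    have hsplit : g' (K x) - g (K x) = g' (K x - y) + (g' y - g y) - g (K x - y) := by
      simp only [map_sub]
      ring
    change ‖g' (K x) - g (K x)‖ ≤ _
    rw [hsplit]
    linarith [norm_sub_le (g' (K x - y) + (g' y - g y)) (g (K x - y)),
      norm_add_le (g' (K x - y)) (g' y - g y), hnorm g' hB' (K x - y), hnorm g hg (K x - y)]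
  refine (isCompactOperator_iff_image_closedBall_subset_compact
    (_root_.banachAdjoint K).toLinearMap one_pos).2 ⟨_, hB.image_of_continuousOn hcont, ?_⟩
  rintro _ ⟨f, hf, rfl⟩
  exact ⟨StrongDual.toWeakDual f, by simpa [B] using hf, rfl⟩

end Adjoint

/-! ### Lowering the power of `S` -/

section Main

variable {𝕜 : Type*} [RCLike 𝕜] {X : Type*} [NormedAddCommGroup X] [NormedSpace 𝕜 X]
  [CompleteSpace X]

theorem IsReflexiveSpace.pow_apply_mem_almostPeriodicVectors (hX : IsReflexiveSpace 𝕜 X)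
    {T : X →L[𝕜] X} (hT : IsPowerBounded T) {α : 𝕜} (hα : ‖α‖ = 1) {S : X →L[𝕜] X}
    (hTS : T = α • ContinuousLinearMap.id 𝕜 X + S) {j : ℕ}
    (hj : ∀ x, (S ^ (j + 1)) x ∈ almostPeriodicVectors T) (x : X) :
    (S ^ j) x ∈ almostPeriodicVectors T := by
  have hα0 : α ≠ 0 := norm_ne_zero_iff.1 (by simp [hα])
  have hU : IsPowerBounded (α⁻¹ • T) := by
    obtain ⟨M, hM⟩ := hT
    exact ⟨M, fun n => by simpa [smul_pow, norm_smul, hα] using hM n⟩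
  have hS : ∀ y, S y = T y - α • y := fun y => by simp [hTS]
  obtain ⟨z, hz, hxz⟩ := hX.exists_fixed_sub_mem_closure_range hU x
  have hTz : T z = α • z := by
    calc T z = α • (α⁻¹ • T) z := by simp [hα0]
      _ = α • z := by rw [hz]
  -- `S z = 0`, so only `j = 0` needs the eigenvector argument.
  have hzM : (S ^ j) z ∈ almostPeriodicVectors T := by
    rcases j with _ | j
    · exact mem_almostPeriodicVectors_of_apply_eq_smul hα.le hTz
    · simp [pow_succ, hS, hTz]
  have hclosed : IsClosed {y | (S ^ j) y ∈ almostPeriodicVectors T} :=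
    hT.isClosed_almostPeriodicVectors.preimage (S ^ j).continuous
  -- `α⁻¹ • T - 1 = α⁻¹ • S`, so `S ^ j` maps its range into that of `S ^ (j + 1)`; closedness
  -- covers the limits.
  have hwM : (S ^ j) (x - z) ∈ almostPeriodicVectors T := by
    refine closure_minimal ?_ hclosed hxz
    rintro _ ⟨y, rfl⟩
    have h : ((α⁻¹ • T - 1 : X →L[𝕜] X) : X →ₗ[𝕜] X) y = S (α⁻¹ • y) := by
      simp [hS, smul_smul, hα0]
    rw [h]
    exact hj (α⁻¹ • y)
  simpa using add_mem hwM hzM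

theorem IsReflexiveSpace.isAlmostPeriodicOperator (hX : IsReflexiveSpace 𝕜 X)
    {T : X →L[𝕜] X} (hT : IsPowerBounded T) {α : 𝕜} {S : X →L[𝕜] X}
    (hTS : T = α • ContinuousLinearMap.id 𝕜 X + S) {k : ℕ} (hk : IsCompactOperator (S ^ k)) :
    IsAlmostPeriodicOperator T := by
  have hS : ∀ y, S y = T y - α • y := fun y => by simp [hTS]
  have hcomm : Commute T S := by
    rw [hTS]
    refine Commute.add_left ?_ (Commute.refl S)
    exact (Commute.one_left S).smul_left α
  have hstep : ∀ j, (∀ x, (S ^ (j + 1)) x ∈ almostPeriodicVectors T) →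
      ∀ x, (S ^ j) x ∈ almostPeriodicVectors T := by
    intro j hj x
    have hj' : T ((S ^ j) x) - α • (S ^ j) x ∈ almostPeriodicVectors T := by
      simpa [pow_succ', hS] using hj x
    rcases lt_trichotomy ‖α‖ 1 with h | h | h
    · exact hT.mem_almostPeriodicVectors_of_norm_lt_one h hj'
    · exact hX.pow_apply_mem_almostPeriodicVectors hT h hTS hj x
    · exact hT.mem_almostPeriodicVectors_of_one_lt_norm h hj'
  have hdesc : ∀ j, (∀ x, (S ^ j) x ∈ almostPeriodicVectors T) →
      ∀ x, x ∈ almostPeriodicVectors T := by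
    intro j
    induction j with
    | zero => exact fun h x => by simpa using h x
    | succ j ih => exact fun h => ih (hstep j h)
  exact isAlmostPeriodicOperator_of_forall_mem <| hdesc k <|
    hT.apply_mem_almostPeriodicVectors_of_commute hk (hcomm.pow_right k)

end Main

theorem mainTheorem1 {𝕜 : Type*} [RCLike 𝕜] {X : Type*} [NormedAddCommGroup X]
    [NormedSpace 𝕜 X] [CompleteSpace X] (hX : IsReflexiveSpace 𝕜 X)
    (T : X →L[𝕜] X) (hT : IsPowerBounded T) (α : 𝕜) (S : X →L[𝕜] X)
    (hTS : T = α • ContinuousLinearMap.id 𝕜 X + S)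
    (k : ℕ) (hk : IsCompactOperator (S ^ k)) :
    IsAlmostPeriodicOperator T ∧ IsAlmostPeriodicOperator (banachAdjoint T) := by
  refine ⟨hX.isAlmostPeriodicOperator hT hTS hk,
    hX.dual.isAlmostPeriodicOperator hT.banachAdjoint (α := α) (S := banachAdjoint S) (k := k)
      ?_ ?_⟩
  · ext f x
    simp [hTS, banachAdjoint_apply_apply]
  · rw [banachAdjoint_pow]
    exact hk.banachAdjoint
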